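/- \textbf{Conventions.} All sets are finite. A \emph{coherent configuration} on $\Omega$ is a partition $S(\mathcal X)$ of $\Omega^2$ (its \emph{basis relations}; unions of basis relations, forming $S(\mathcal X)^\cup$, are the \emph{relations} of $\mathcal X$) such that the diagonal $1_\Omega$ is a relation, the converse of a basis relation is a basis relation, and for $r,s,t\in S(\mathcal X)$ the number $c_{rs}^t=|\{\gamma:(\alpha,\gamma)\in r,\ (\gamma,\beta)\in s\}|$ does not depend on $(\alpha,\beta)\in t$. An \emph{algebraic isomorphism} $\varphi:\mathcal X\to\mathcal X'$ is a bijection $S(\mathcal X)\to S(\mathcal X')$ with $c_{rs}^t=c_{\varphi(r)\varphi(s)}^{\varphi(t)}$ for all $r,s,t$; it is extended to a map $S(\mathcal X)^\cup\to S(\mathcal X')^\cup$ by taking unions. $\mathrm{WL}(r,s,\ldots)$ is the smallest (coarsest) coherent configuration having $r,s,\ldots$ as relations; for a simple undirected graph $X$ with edge set $E(X)\subseteq\Omega^2$ (an irreflexive symmetric relation), $\mathrm{WL}(X)=\mathrm{WL}(E(X))$. The tensor product $\mathcal X\otimes\mathcal X$ is the coherent configuration on $\Omega^2$ with basis relations $s_1\otimes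 s_2=\{(x,y)\in\Omega^2\times\Omega^2:(x_1,y_1)\in s_1,\ (x_2,y_2)\in s_2\}$, $s_1,s_2\in S(\mathcal X)$. The \emph{$2$-extension} of $\mathcal X$ is $\hat{\mathcal X}=\mathrm{WL}(S(\mathcal X\otimes\mathcal X)\cup\{1_\Delta\})$, where $\Delta=\{(\alpha,\alpha):\alpha\in\Omega\}$ and $1_\Delta=\{(x,x):x\in\Delta\}$. For $s\subseteq\Omega^2$ and $i,j\in\{1,2\}$, $\mathrm{cyl}_s(i,j)=\{(x,y)\in\Omega^2\times\Omega^2:(x_i,y_j)\in s\}$. For $m\ge 2$, $\mathrm{WL}_m(\mathcal X)$ is the partition of $\Omega^m$ produced by the $m$-dimensional Weisfeiler--Leman algorithm: initially $x,y\in\Omega^m$ have the same colour iff, for all $i,j$, the pairs $(x_i,x_j)$ and $(y_i,y_j)$ lie in the same basis relation of $\mathcal X$; in each round $x$ and $y$ keep the same colour iff they had the same colour and the multisets, over $\alpha\in\Omega$, of the $m$-tuples of colours of $x_{1\leftarrow\alpha},\ldots,x_{m\leftarrow\alpha}$ and of $y_{1\leftarrow\alpha},\ldots,y_{m\leftarrow\alpha}$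 coincide, where $x_{i\leftarrow\alpha}$ is $x$ with its $i$th coordinate replaced by $\alpha$; the classes of $\mathrm{WL}_m(\mathcal X)$ are the colour classes of the stable colouring. An algebraic isomorphism $\mathrm{WL}_m(\mathcal X)\to\mathrm{WL}_m(\mathcal X')$ is a bijection $\psi$ between the classes that preserves, for each class $\Lambda$, the set of pairs $(i,j)$ with $x_i=x_j$ for $x\in\Lambda$, satisfies $\psi(\Lambda^\sigma)=\psi(\Lambda)^\sigma$ for every map $\sigma:\{1,\ldots,m\}\to\{1,\ldots,m\}$, where $\Lambda^\sigma=\{(x_{\sigma(1)},\ldots,x_{\sigma(m)}):x\in\Lambda\}$, and preserves the intersection numbers $|\{\alpha\in\Omega: x_{i\leftarrow\alpha}\in\Lambda_i\text{ for }i=1,\ldots,m\}|$, $x\in\Lambda_0$, for all classes $\Lambda_0,\ldots,\Lambda_m$. It induces a map $\psi_2$ on unions of the projections $\mathrm{pr}_2\Lambda=\{(x_1,x_2):x\in\Lambda\}$, with $\psi_2(\mathrm{pr}_2\Lambda)=\mathrm{pr}_2\psi(\Lambda)$. Graphs $X$ and $X'$ are \emph{$\mathrm{WL}_m$-equivalent}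 if there is an algebraic isomorphism $\psi:\mathrm{WL}_m(\mathrm{WL}(X))\to\mathrm{WL}_m(\mathrm{WL}(X'))$ such that $\psi_2(E(X))=E(X')$. \textbf{Theorem.} Let $m\ge 6$ be an integer, let $X$ and $X'$ be $\mathrm{WL}_m$-equivalent graphs, and put $\mathcal X=\mathrm{WL}(X)$, $\mathcal X'=\mathrm{WL}(X')$. Then there are algebraic isomorphisms $\varphi:\mathcal X\to\mathcal X'$ and $\hat\varphi:\hat{\mathcal X}\to\hat{\mathcal X}'$ such that $\varphi(E(X))=E(X')$ and, for every relation $s\in S(\mathcal X)^\cup$ and all $i,j\in\{1,2\}$, the set $\mathrm{cyl}_s(i,j)$ is a relation of $\hat{\mathcal X}$ and $$\hat\varphi(\mathrm{cyl}_s(i,j))=\mathrm{cyl}_{\varphi(s)}(i,j).$$ -/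

import Mathlib

/-- `classUnions S` is the set `S^∪` of all unions of elements of `S`. -/
def classUnions {A : Type*} (S : Set (Set A)) : Set (Set A) :=
  {r | ∃ T ⊆ S, r = ⋃₀ T}

theorem mem_classUnions_iff {A : Type*} {S : Set (Set A)} (hS : Setoid.IsPartition S)
    {r : Set A} :
    r ∈ classUnions S ↔ ∀ t ∈ S, ∀ p ∈ t, ∀ q ∈ t, p ∈ r → q ∈ r := by
  constructor
  · rintro ⟨T, hT, rfl⟩ t ht p hp q hq ⟨u, hu, hpu⟩
    obtain rfl : t = u := (hS.2 p).unique ⟨ht, hp⟩ ⟨hT hu, hpu⟩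
    exact ⟨t, hu, hq⟩
  · intro h
    refine ⟨{t | t ∈ S ∧ t ⊆ r}, fun t ht => ht.1, ?_⟩
    ext p
    constructor
    · intro hp
      obtain ⟨t, ⟨ht, hpt⟩, -⟩ := hS.2 p
      exact ⟨t, ⟨ht, fun q hq => h t ht p hpt q hq hp⟩, hpt⟩
    · rintro ⟨t, ⟨-, htr⟩, hpt⟩
      exact htr hpt

theorem mem_classUnions_of_mem {A : Type*} {S : Set (Set A)} {r : Set A} (hr : r ∈ S) :
    r ∈ classUnions S :=
  ⟨{r}, by simpa using hr, by simp⟩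

/-- For binary relations `r`, `s` and a pair `p = (α, β)`, the number
`|α r ∩ β s^*|` of points `γ` with `(α, γ) ∈ r` and `(γ, β) ∈ s`. -/
noncomputable def pathCount {Ω : Type*} (r s : Set (Ω × Ω)) (p : Ω × Ω) : ℕ :=
  {γ : Ω | (p.1, γ) ∈ r ∧ (γ, p.2) ∈ s}.ncard

/-- A coherent configuration on a (finite) set `Ω`: a partition `S` of `Ω × Ω` such that the
diagonal is a union of classes, the converse of a class is a class, and the intersection
numbers `c_{r,s}^t` are well defined. -/
structure CoherentConfiguration (Ω : Type*) where
  S : Set (Set (Ω × Ω))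
  isPartition : Setoid.IsPartition S
  diag_mem : {p : Ω × Ω | p.1 = p.2} ∈ classUnions S
  converse_mem : ∀ s ∈ S, {p : Ω × Ω | (p.2, p.1) ∈ s} ∈ S
  pathCount_eq : ∀ r ∈ S, ∀ s ∈ S, ∀ t ∈ S, ∀ p ∈ t, ∀ q ∈ t,
    pathCount r s p = pathCount r s q

namespace CoherentConfiguration

variable {Ω : Type*}

/-- The set of all relations of a coherent configuration, i.e. the unions of basis relations. -/
def relations (C : CoherentConfiguration Ω) : Set (Set (Ω × Ω)) := classUnions C.S

/-- `C ≤ D` if each basis relation of `C` is a union of basis relations of `D`. -/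
instance : LE (CoherentConfiguration Ω) := ⟨fun C D => ∀ s ∈ C.S, s ∈ D.relations⟩

theorem mem_relations_iff (C : CoherentConfiguration Ω) {r : Set (Ω × Ω)} :
    r ∈ C.relations ↔ ∀ t ∈ C.S, ∀ p ∈ t, ∀ q ∈ t, p ∈ r → q ∈ r :=
  mem_classUnions_iff C.isPartition

theorem pathCount_eq_of_relations [Finite Ω] (C : CoherentConfiguration Ω)
    {r s : Set (Ω × Ω)} (hr : r ∈ C.relations) (hs : s ∈ C.relations)
    {t : Set (Ω × Ω)} (ht : t ∈ C.S) {p q : Ω × Ω} (hp : p ∈ t) (hq : q ∈ t) :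
    pathCount r s p = pathCount r s q := by
  classical
  have := Fintype.ofFinite Ω
  rw [mem_relations_iff] at hr hs
  choose cl hcl hun using fun p => C.isPartition.2 p
  have key : ∀ p : Ω × Ω, ∀ a ∈ C.S, (p ∈ a ↔ cl p = a) := by
    intro p a ha
    constructor
    · intro h
      exact (hun p a ⟨ha, h⟩).symm
    · rintro rfl
      exact (hcl p).2
  have fib : ∀ p : Ω × Ω, pathCount r s p =
      ∑ ab ∈ (Finset.univ.image (fun x : (Ω × Ω) × (Ω × Ω) => (cl x.1, cl x.2))).filter
        (fun ab => ab.1 ⊆ r ∧ ab.2 ⊆ s), pathCount ab.1 ab.2 p := by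
    intro p
    unfold pathCount
    rw [Set.ncard_eq_toFinset_card']
    rw [Finset.card_eq_sum_card_fiberwise (f := fun γ => (cl (p.1, γ), cl (γ, p.2)))
      (t := (Finset.univ.image (fun x : (Ω × Ω) × (Ω × Ω) => (cl x.1, cl x.2))).filter
        (fun ab => ab.1 ⊆ r ∧ ab.2 ⊆ s))]
    · refine Finset.sum_congr rfl ?_
      rintro ⟨a, b⟩ hab
      rw [Finset.mem_filter, Finset.mem_image] at hab
      obtain ⟨⟨x, -, hx⟩, har, hbs⟩ := hab
      have ha : a ∈ C.S := by
        have := (hcl x.1).1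
        rw [Prod.mk.injEq] at hx
        rwa [hx.1] at this
      have hb : b ∈ C.S := by
        have := (hcl x.2).1
        rw [Prod.mk.injEq] at hx
        rwa [hx.2] at this
      rw [Set.ncard_eq_toFinset_card']
      congr 1
      ext γ
      simp only [Finset.mem_filter, Set.mem_toFinset, Set.mem_ofPred_eq, Prod.mk.injEq]
      rw [← key _ a ha, ← key _ b hb]
      constructor
      · exact fun h => h.2
      · exact fun h => ⟨⟨har h.1, hbs h.2⟩, h⟩
    · intro γ hγ
      simp only [Set.coe_toFinset, Set.mem_ofPred_eq] at hγ
      simp only [Finset.coe_filter, Set.mem_ofPred_eq, Finset.mem_image, Finset.mem_univ, true_and]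
      exact ⟨⟨((p.1, γ), (γ, p.2)), rfl⟩,
        fun x hx => hr _ (hcl (p.1, γ)).1 _ (hcl (p.1, γ)).2 x hx hγ.1,
        fun x hx => hs _ (hcl (γ, p.2)).1 _ (hcl (γ, p.2)).2 x hx hγ.2⟩
  rw [fib p, fib q]
  refine Finset.sum_congr rfl ?_
  rintro ⟨a, b⟩ hab
  rw [Finset.mem_filter, Finset.mem_image] at hab
  obtain ⟨⟨x, -, hx⟩, -, -⟩ := hab
  rw [Prod.mk.injEq] at hx
  exact C.pathCount_eq a (hx.1 ▸ (hcl x.1).1) b (hx.2 ▸ (hcl x.2).1) t ht p hp q hq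

/-- The relations common to all coherent configurations having every member of `R` among
their relations. -/
def commonRelations (R : Set (Set (Ω × Ω))) : Set (Set (Ω × Ω)) :=
  {r | ∀ D : CoherentConfiguration Ω, (∀ u ∈ R, u ∈ D.relations) → r ∈ D.relations}

/-- Two pairs are equivalent if they are not separated by `commonRelations R`. -/
def closureSetoid (R : Set (Set (Ω × Ω))) : Setoid (Ω × Ω) where
  r p q := ∀ r ∈ commonRelations R, (p ∈ r ↔ q ∈ r)
  iseqv := ⟨fun _ _ _ => Iff.rfl, fun h r hr => (h r hr).symm,
    fun h k r hr => (h r hr).trans (k r hr)⟩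

theorem relations_compl (C : CoherentConfiguration Ω) {r : Set (Ω × Ω)}
    (hr : r ∈ C.relations) : rᶜ ∈ C.relations := by
  rw [mem_relations_iff] at hr ⊢
  exact fun t ht p hp q hq hpr hqr => hpr (hr t ht q hq p hp hqr)

theorem closureSetoid_saturated (R : Set (Set (Ω × Ω))) (r : Set (Ω × Ω)) :
    r ∈ commonRelations R ↔ ∀ p q, closureSetoid R p q → p ∈ r → q ∈ r := by
  constructor
  · intro hr p q h hp
    exact (h r hr).1 hp
  · intro h D hD
    rw [mem_relations_iff]
    intro t ht p hp q hq hpr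
    refine h p q (fun u hu => ?_) hpr
    have := (mem_relations_iff D).1 (hu D hD)
    exact ⟨this t ht p hp q hq, this t ht q hq p hp⟩

theorem class_mem_commonRelations (R : Set (Set (Ω × Ω))) {s : Set (Ω × Ω)}
    (hs : s ∈ (closureSetoid R).classes) : s ∈ commonRelations R := by
  obtain ⟨y, rfl⟩ := hs
  rw [closureSetoid_saturated]
  intro p q h hp
  exact (closureSetoid R).trans ((closureSetoid R).symm h) hp

theorem relations_converse (C : CoherentConfiguration Ω) {r : Set (Ω × Ω)}
    (hr : r ∈ C.relations) : {p : Ω × Ω | (p.2, p.1) ∈ r} ∈ C.relations := by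
  rw [mem_relations_iff] at hr ⊢
  intro t ht p hp q hq h
  exact hr _ (C.converse_mem t ht) (p.2, p.1) hp (q.2, q.1) hq h

/-- The coherent closure `WL(R)`: the smallest coherent configuration containing each member of
`R` as a relation (see `coherentClosure_isLeast`). -/
def coherentClosure [Finite Ω] (R : Set (Set (Ω × Ω))) : CoherentConfiguration Ω where
  S := (closureSetoid R).classes
  isPartition := Setoid.isPartition_classes _
  diag_mem := by
    rw [mem_classUnions_iff (Setoid.isPartition_classes _)]
    rintro t ⟨y, rfl⟩ p hp q hq hpd
    have h : closureSetoid R p q :=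
      (closureSetoid R).trans hp ((closureSetoid R).symm hq)
    exact (h _ (fun D _ => D.diag_mem)).1 hpd
  converse_mem := by
    have sw : ∀ p q : Ω × Ω, closureSetoid R p q → closureSetoid R (p.2, p.1) (q.2, q.1) := by
      intro p q h r hr
      exact h {p : Ω × Ω | (p.2, p.1) ∈ r} (fun D hD => D.relations_converse (hr D hD))
    rintro s ⟨y, rfl⟩
    refine ⟨(y.2, y.1), ?_⟩
    ext p
    exact ⟨fun h => sw _ _ h, fun h => sw _ _ h⟩
  pathCount_eq := by
    rintro r hr s hs t ⟨y, rfl⟩ p hp q hq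
    have h : closureSetoid R p q :=
      (closureSetoid R).trans hp ((closureSetoid R).symm hq)
    have hc : {x | pathCount r s x = pathCount r s q} ∈ commonRelations R := by
      intro D hD
      rw [mem_relations_iff]
      intro t ht a ha b hb hab
      exact (D.pathCount_eq_of_relations (class_mem_commonRelations R hr D hD)
        (class_mem_commonRelations R hs D hD) ht hb ha).trans hab
    exact (h _ hc).2 rfl

theorem mem_coherentClosure_relations [Finite Ω] (R : Set (Set (Ω × Ω))) (r : Set (Ω × Ω)) :
    r ∈ (coherentClosure R).relations ↔ r ∈ commonRelations R := by
  rw [closureSetoid_saturated, mem_relations_iff]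
  constructor
  · intro h p q hpq hp
    exact h _ ((closureSetoid R).mem_classes p) p ((closureSetoid R).refl p) q
      ((closureSetoid R).symm hpq) hp
  · rintro h t ⟨y, rfl⟩ p hp q hq
    exact h p q ((closureSetoid R).trans hp ((closureSetoid R).symm hq))

theorem coherentClosure_isLeast [Finite Ω] (R : Set (Set (Ω × Ω))) :
    (∀ u ∈ R, u ∈ (coherentClosure R).relations) ∧
      ∀ D : CoherentConfiguration Ω, (∀ u ∈ R, u ∈ D.relations) → coherentClosure R ≤ D :=
  ⟨fun u hu => (mem_coherentClosure_relations R u).2 fun _ hD => hD u hu,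
    fun D hD _ hs => class_mem_commonRelations R hs D hD⟩

/-- The tensor product `s₁ ⊗ s₂` of two binary relations. -/
def relTensor {Ω₁ Ω₂ : Type*} (s₁ : Set (Ω₁ × Ω₁)) (s₂ : Set (Ω₂ × Ω₂)) :
    Set ((Ω₁ × Ω₂) × (Ω₁ × Ω₂)) :=
  {p | (p.1.1, p.2.1) ∈ s₁ ∧ (p.1.2, p.2.2) ∈ s₂}

theorem pathCount_relTensor {Ω₁ Ω₂ : Type*} (r₁ s₁ : Set (Ω₁ × Ω₁)) (r₂ s₂ : Set (Ω₂ × Ω₂))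
    (p : (Ω₁ × Ω₂) × (Ω₁ × Ω₂)) :
    pathCount (relTensor r₁ r₂) (relTensor s₁ s₂) p =
      pathCount r₁ s₁ (p.1.1, p.2.1) * pathCount r₂ s₂ (p.1.2, p.2.2) := by
  unfold pathCount
  rw [← Set.ncard_prod]
  congr 1
  ext γ
  simp only [relTensor, Set.mem_ofPred_eq, Set.mem_prod]
  tauto

theorem isPartition_tensor {Ω₁ Ω₂ : Type*} (C₁ : CoherentConfiguration Ω₁)
    (C₂ : CoherentConfiguration Ω₂) :
    Setoid.IsPartition {t | ∃ s₁ ∈ C₁.S, ∃ s₂ ∈ C₂.S, t = relTensor s₁ s₂} := by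
  constructor
  · rintro ⟨s₁, h₁, s₂, h₂, h⟩
    obtain ⟨p₁, hp₁⟩ := Setoid.nonempty_of_mem_partition C₁.isPartition h₁
    obtain ⟨p₂, hp₂⟩ := Setoid.nonempty_of_mem_partition C₂.isPartition h₂
    have : ((p₁.1, p₂.1), (p₁.2, p₂.2)) ∈ relTensor s₁ s₂ := ⟨hp₁, hp₂⟩
    rw [← h] at this
    exact this
  · intro p
    obtain ⟨a, ha, hau⟩ := C₁.isPartition.2 (p.1.1, p.2.1)
    obtain ⟨b, hb, hbu⟩ := C₂.isPartition.2 (p.1.2, p.2.2)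
    refine ⟨relTensor a b, ⟨⟨a, ha.1, b, hb.1, rfl⟩, ha.2, hb.2⟩, ?_⟩
    rintro t ⟨⟨a', ha', b', hb', rfl⟩, h1, h2⟩
    rw [hau a' ⟨ha', h1⟩, hbu b' ⟨hb', h2⟩]

/-- The tensor product of two coherent configurations. -/
def tensor {Ω₁ Ω₂ : Type*} (C₁ : CoherentConfiguration Ω₁) (C₂ : CoherentConfiguration Ω₂) :
    CoherentConfiguration (Ω₁ × Ω₂) where
  S := {t | ∃ s₁ ∈ C₁.S, ∃ s₂ ∈ C₂.S, t = relTensor s₁ s₂}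
  isPartition := isPartition_tensor C₁ C₂
  diag_mem := by
    rw [mem_classUnions_iff (isPartition_tensor C₁ C₂)]
    rintro t ⟨s₁, h₁, s₂, h₂, rfl⟩ p hp q hq hpd
    have hpd' : p.1 = p.2 := hpd
    have e₁ := (mem_relations_iff C₁).1 C₁.diag_mem s₁ h₁ _ hp.1 _ hq.1
      (congrArg Prod.fst hpd')
    have e₂ := (mem_relations_iff C₂).1 C₂.diag_mem s₂ h₂ _ hp.2 _ hq.2
      (congrArg Prod.snd hpd')
    exact Prod.ext e₁ e₂
  converse_mem := by
    rintro t ⟨s₁, h₁, s₂, h₂, rfl⟩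
    exact ⟨_, C₁.converse_mem s₁ h₁, _, C₂.converse_mem s₂ h₂, rfl⟩
  pathCount_eq := by
    rintro _ ⟨r₁, hr₁, r₂, hr₂, rfl⟩ _ ⟨s₁, hs₁, s₂, hs₂, rfl⟩ _ ⟨t₁, ht₁, t₂, ht₂, rfl⟩ p hp q hq
    rw [pathCount_relTensor, pathCount_relTensor,
      C₁.pathCount_eq r₁ hr₁ s₁ hs₁ t₁ ht₁ _ hp.1 _ hq.1,
      C₂.pathCount_eq r₂ hr₂ s₂ hs₂ t₂ ht₂ _ hp.2 _ hq.2]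

/-- The `2`-extension of `C`: the coherent closure of `C ⊗ C` together with the relation `1_Δ`,
where `Δ` is the diagonal of `Ω × Ω`. -/
def twoExtension [Finite Ω] (C : CoherentConfiguration Ω) : CoherentConfiguration (Ω × Ω) :=
  coherentClosure ((C.tensor C).S ∪ {{p | p.1 = p.2 ∧ p.1.1 = p.1.2}})

end CoherentConfiguration

/-- An algebraic isomorphism of coherent configurations: a bijection between the basis relations
that preserves the intersection numbers. -/
structure AlgIso {Ω Ω' : Type*} (C : CoherentConfiguration Ω) (C' : CoherentConfiguration Ω') where
  toEquiv : C.S ≃ C'.S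
  map_pathCount : ∀ r s t : C.S, ∀ p ∈ t.1, ∀ p' ∈ (toEquiv t).1,
    pathCount (toEquiv r).1 (toEquiv s).1 p' = pathCount r.1 s.1 p

/-- The induced map on unions of basis relations: a relation `r` goes to the union of the images
of the basis relations contained in `r`. -/
def AlgIso.map {Ω Ω' : Type*} {C : CoherentConfiguration Ω} {C' : CoherentConfiguration Ω'}
    (φ : AlgIso C C') (r : Set (Ω × Ω)) : Set (Ω' × Ω') :=
  {p' | ∃ t : C.S, t.1 ⊆ r ∧ p' ∈ (φ.toEquiv t).1}

/-- For a set `Λ` of `m`-tuples and `σ : {1,…,m} → {1,…,m}`, the set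
`Λ^σ = {(x_{σ(1)}, …, x_{σ(m)}) : x ∈ Λ}`. -/
def tupleReindex {Ω : Type*} {m : ℕ} (σ : Fin m → Fin m) (Λ : Set (Fin m → Ω)) :
    Set (Fin m → Ω) :=
  (fun x => x ∘ σ) '' Λ

/-- For an `m`-tuple `x` and sets `Λ₁, …, Λ_m` of `m`-tuples, the number of points `α` such that
for each `i`, replacing the `i`-th coordinate of `x` by `α` gives an element of `Λ_i`. -/
noncomputable def substCount {Ω : Type*} {m : ℕ} (Λ : Fin m → Set (Fin m → Ω))
    (x : Fin m → Ω) : ℕ :=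
  {α : Ω | ∀ i, Function.update x i α ∈ Λ i}.ncard

/-- An `m`-ary coherent configuration (in the sense of Babai) on a (finite) set `Ω`. -/
structure MAryCoherentConfiguration (m : ℕ) (Ω : Type*) where
  S : Set (Set (Fin m → Ω))
  isPartition : Setoid.IsPartition S
  eq_iff : ∀ Λ ∈ S, ∀ x ∈ Λ, ∀ y ∈ Λ, ∀ i j, x i = x j ↔ y i = y j
  reindex_mem : ∀ σ : Fin m → Fin m, ∀ Λ ∈ S, tupleReindex σ Λ ∈ S
  substCount_eq : ∀ Λ : Fin m → Set (Fin m → Ω), (∀ i, Λ i ∈ S) →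
    ∀ Λ₀ ∈ S, ∀ x ∈ Λ₀, ∀ y ∈ Λ₀, substCount Λ x = substCount Λ y

/-- An algebraic isomorphism of `m`-ary coherent configurations: a bijection between the classes
that preserves the equality type of the tuples, commutes with every reindexing of the coordinates,
and preserves the intersection numbers. -/
structure MAryAlgIso {m : ℕ} {Ω Ω' : Type*} (C : MAryCoherentConfiguration m Ω)
    (C' : MAryCoherentConfiguration m Ω') where
  toEquiv : C.S ≃ C'.S
  map_eq_iff : ∀ Λ : C.S, ∀ x ∈ Λ.1, ∀ x' ∈ (toEquiv Λ).1, ∀ i j, x i = x j ↔ x' i = x' j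
  map_reindex : ∀ (σ : Fin m → Fin m) (Λ : C.S),
    (toEquiv ⟨tupleReindex σ Λ.1, C.reindex_mem σ Λ.1 Λ.2⟩).1 = tupleReindex σ (toEquiv Λ).1
  map_substCount : ∀ (Λ : Fin m → C.S) (Λ₀ : C.S), ∀ x ∈ Λ₀.1, ∀ x' ∈ (toEquiv Λ₀).1,
    substCount (fun i => (toEquiv (Λ i)).1) x' = substCount (fun i => (Λ i).1) x

/-- The projection of a set of `m`-tuples to the first two coordinates. -/
def pr2 {Ω : Type*} {m : ℕ} (hm : 2 ≤ m) (Λ : Set (Fin m → Ω)) : Set (Ω × Ω) :=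
  (fun x => (x ⟨0, by omega⟩, x ⟨1, by omega⟩)) '' Λ

/-- The map `φ₂` induced by `φ` on unions of classes of `pr₂ C`; it sends `pr₂ Λ` to
`pr₂ (φ Λ)` for every class `Λ`. -/
def MAryAlgIso.map2 {m : ℕ} (hm : 2 ≤ m) {Ω Ω' : Type*} {C : MAryCoherentConfiguration m Ω}
    {C' : MAryCoherentConfiguration m Ω'} (φ : MAryAlgIso C C') (r : Set (Ω × Ω)) :
    Set (Ω' × Ω') :=
  {p' | ∃ Λ : C.S, pr2 hm Λ.1 ⊆ r ∧ p' ∈ pr2 hm (φ.toEquiv Λ).1}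

namespace WeisfeilerLeman

variable {Ω : Type*} {m : ℕ}

/-- The initial colouring: two `m`-tuples `x`, `y` have the same colour if for all `i`, `j` the
pairs `(x_i, x_j)` and `(y_i, y_j)` lie in the same basis relation of `C`. -/
def initial (m : ℕ) (C : CoherentConfiguration Ω) : Setoid (Fin m → Ω) where
  r x y := ∀ i j, ∀ s ∈ C.S, ((x i, x j) ∈ s ↔ (y i, y j) ∈ s)
  iseqv := ⟨fun _ _ _ _ _ => Iff.rfl, fun h i j s hs => (h i j s hs).symm,
    fun h k i j s hs => (h i j s hs).trans (k i j s hs)⟩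

/-- One round of refinement: `x` and `y` keep the same colour if they had the same colour and the
multisets, over `α ∈ Ω`, of the tuples of colours of `x_{1←α}, …, x_{m←α}` and of
`y_{1←α}, …, y_{m←α}` coincide; that is, some permutation of `Ω` matches these tuples. -/
def refine (r : Setoid (Fin m → Ω)) : Setoid (Fin m → Ω) where
  r x y := r x y ∧ ∃ π : Equiv.Perm Ω, ∀ α i,
    r (Function.update x i α) (Function.update y i (π α))
  iseqv := by
    refine ⟨fun x => ⟨r.refl x, 1, fun α i => r.refl _⟩, ?_, ?_⟩
    · rintro x y ⟨h, π, hπ⟩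
      refine ⟨r.symm h, π.symm, fun α i => r.symm ?_⟩
      simpa using hπ (π.symm α) i
    · rintro x y z ⟨h, π, hπ⟩ ⟨k, τ, hτ⟩
      exact ⟨r.trans h k, π.trans τ, fun α i => r.trans (hπ α i) (hτ (π α) i)⟩

/-- The colouring after `n` rounds. -/
def round (C : CoherentConfiguration Ω) (n : ℕ) : Setoid (Fin m → Ω) :=
  refine^[n] (initial m C)

/-- The stable colouring: two tuples have the same final colour if no round separates them. -/
def stable (m : ℕ) (C : CoherentConfiguration Ω) : Setoid (Fin m → Ω) where
  r x y := ∀ n, round C n x y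
  iseqv := ⟨fun x n => (round C n).refl x, fun h n => (round C n).symm (h n),
    fun h k n => (round C n).trans (h n) (k n)⟩

theorem round_succ (C : CoherentConfiguration Ω) (n : ℕ) :
    (round C (n + 1) : Setoid (Fin m → Ω)) = refine (round C n) :=
  Function.iterate_succ_apply' _ _ _

theorem round_anti (C : CoherentConfiguration Ω) {a b : ℕ} (hab : a ≤ b) {x y : Fin m → Ω}
    (h : round C b x y) : round C a x y := by
  induction hab with
  | refl => exact h
  | step _ ih =>
    rw [round_succ] at h
    exact ih h.1

theorem stable_extend [Finite Ω] (C : CoherentConfiguration Ω) {x y : Fin m → Ω}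
    (h : stable m C x y) : ∃ π : Equiv.Perm Ω, ∀ α i,
      stable m C (Function.update x i α) (Function.update y i (π α)) := by
  have h1 : ∀ n, ∃ π : Equiv.Perm Ω, ∀ α i,
      round C n (Function.update x i α) (Function.update y i (π α)) := by
    intro n
    have := h (n + 1)
    rw [round_succ] at this
    exact this.2
  choose f hf using h1
  obtain ⟨π, hπ⟩ := Finite.exists_infinite_fiber f
  refine ⟨π, fun α i n => ?_⟩
  obtain ⟨k, hk, hnk⟩ := (Set.infinite_coe_iff.1 hπ).exists_gt n
  have hk' : f k = π := hk
  exact round_anti C hnk.le (hk' ▸ hf k α i)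

theorem initial_eq_iff (C : CoherentConfiguration Ω) {x y : Fin m → Ω} (h : initial m C x y)
    (i j : Fin m) : x i = x j ↔ y i = y j := by
  obtain ⟨s, ⟨hs, hx⟩, -⟩ := C.isPartition.2 (x i, x j)
  have hy := (h i j s hs).1 hx
  exact ⟨(C.mem_relations_iff.1 C.diag_mem) s hs _ hx _ hy,
    (C.mem_relations_iff.1 C.diag_mem) s hs _ hy _ hx⟩

theorem exists_update_comp (σ : Fin m → Fin m) (i : Fin m) :
    ∃ (k : Fin m) (σ' : Fin m → Fin m), ∀ (x : Fin m → Ω) (α : Ω),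
      Function.update (x ∘ σ) i α = Function.update x k α ∘ σ' := by
  obtain ⟨k, hk⟩ : ∃ k, ∀ j, j ≠ i → σ j ≠ k := by
    by_contra hcon
    push Not at hcon
    choose g hg hgk using hcon
    have hinj : Function.Injective g := fun a b hab => by rw [← hgk a, ← hgk b, hab]
    obtain ⟨a, ha⟩ := (Finite.injective_iff_surjective.1 hinj) i
    exact hg a ha
  refine ⟨k, Function.update σ i k, fun x α => ?_⟩
  funext j
  by_cases hj : j = i
  · subst hj
    simp
  · simp [hj, hk j hj]

theorem stable_comp [Finite Ω] (C : CoherentConfiguration Ω) (σ : Fin m → Fin m)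
    {x y : Fin m → Ω} (h : stable m C x y) : stable m C (x ∘ σ) (y ∘ σ) := by
  intro n
  induction n generalizing σ x y with
  | zero => exact fun i j s hs => h 0 (σ i) (σ j) s hs
  | succ n ih =>
    rw [round_succ]
    refine ⟨ih σ h, ?_⟩
    obtain ⟨π, hπ⟩ := stable_extend C h
    refine ⟨π, fun α i => ?_⟩
    obtain ⟨k, σ', hσ'⟩ := exists_update_comp (Ω := Ω) σ i
    rw [hσ', hσ']
    exact ih σ' (hπ α k)

theorem stable_piecewise [Finite Ω] (C : CoherentConfiguration Ω) (x : Fin m → Ω)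
    (T : Finset (Fin m)) {u w : Fin m → Ω} (h : stable m C u w) :
    ∃ w', (∀ i, i ∉ T → w' i = w i) ∧ stable m C (T.piecewise x u) w' := by
  induction T using Finset.induction_on with
  | empty => exact ⟨w, fun _ _ => rfl, by simpa using h⟩
  | insert a T ha ih =>
    obtain ⟨w', hw', hs⟩ := ih
    obtain ⟨π, hπ⟩ := stable_extend C hs
    refine ⟨Function.update w' a (π (x a)), ?_, ?_⟩
    · intro i hi
      rw [Finset.mem_insert, not_or] at hi
      rw [Function.update_of_ne hi.1, hw' i hi.2]
    · rw [Finset.piecewise_insert]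
      exact hπ (x a) a

theorem stable_lift [Finite Ω] (C : CoherentConfiguration Ω) (σ : Fin m → Fin m)
    {x z : Fin m → Ω} (h : stable m C (x ∘ σ) z) : ∃ y, stable m C x y ∧ y ∘ σ = z := by
  classical
  have hz : ∀ i j, σ i = σ j → z i = z j := fun i j hij =>
    (initial_eq_iff C (h 0) i j).1 (congrArg x hij)
  let τ : Fin m → Fin m := fun k => if hk : ∃ i, σ i = k then hk.choose else k
  have hτ : ∀ i, σ (τ (σ i)) = σ i := by
    intro i
    have hk : ∃ j, σ j = σ i := ⟨i, rfl⟩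
    simp only [τ, dif_pos hk]
    exact hk.choose_spec
  obtain ⟨w, hw, hs⟩ := stable_piecewise C x (Finset.univ.filter fun k => ¬ ∃ i, σ i = k)
    (stable_comp C τ h)
  refine ⟨w, ?_, ?_⟩
  · convert hs using 1
    funext k
    by_cases hk : ∃ i, σ i = k
    · obtain ⟨i, rfl⟩ := hk
      rw [Finset.piecewise_eq_of_notMem _ _ _ (by simp)]
      simp [hτ]
    · rw [Finset.piecewise_eq_of_mem _ _ _ (by simpa using hk)]
  · funext i
    have := hw (σ i) (by simp)
    simp only [Function.comp_apply] at this ⊢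
    rw [this]
    exact hz _ _ (hτ i)

end WeisfeilerLeman

open WeisfeilerLeman in
/-- `WL_m(C)`: the `m`-ary coherent configuration on `Ω` whose classes are the colour classes of
the stable colouring of the `m`-dimensional Weisfeiler–Leman algorithm applied to `C`. -/
def WLm {Ω : Type*} [Finite Ω] (m : ℕ) (C : CoherentConfiguration Ω) :
    MAryCoherentConfiguration m Ω where
  S := (stable m C).classes
  isPartition := Setoid.isPartition_classes _
  eq_iff := by
    rintro Λ ⟨z, rfl⟩ x hx y hy i j
    exact initial_eq_iff C ((stable m C).trans hx ((stable m C).symm hy) 0) i j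
  reindex_mem := by
    rintro σ Λ ⟨z, rfl⟩
    refine ⟨z ∘ σ, ?_⟩
    ext w
    constructor
    · rintro ⟨y, hy, rfl⟩
      exact stable_comp C σ hy
    · intro hw
      obtain ⟨y, hy, rfl⟩ := stable_lift C σ ((stable m C).symm hw)
      exact ⟨y, (stable m C).symm hy, rfl⟩
  substCount_eq := by
    rintro Λ hΛ _ ⟨z, rfl⟩ x hx y hy
    obtain ⟨π, hπ⟩ := stable_extend C ((stable m C).trans hx ((stable m C).symm hy))
    have hmem : ∀ α i, Function.update x i α ∈ Λ i ↔ Function.update y i (π α) ∈ Λ i := by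
      intro α i
      obtain ⟨v, hv⟩ := hΛ i
      rw [hv]
      exact ⟨fun h => (stable m C).trans ((stable m C).symm (hπ α i)) h,
        fun h => (stable m C).trans (hπ α i) h⟩
    unfold substCount
    refine Set.ncard_congr (fun α _ => π α) ?_ ?_ ?_
    · exact fun α hα i => (hmem α i).1 (hα i)
    · exact fun a b _ _ hab => π.injective hab
    · exact fun b hb => ⟨π.symm b, fun i => (hmem _ i).2 (by simpa using hb i), by simp⟩

/-- The edge set of a graph as an (irreflexive, symmetric) binary relation. -/
def edgeRel {Ω : Type*} (X : SimpleGraph Ω) : Set (Ω × Ω) := {p | X.Adj p.1 p.2}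

/-- The coherent configuration `WL(X)` of a graph: the coherent closure of its edge set. -/
def WL {Ω : Type*} [Finite Ω] (X : SimpleGraph Ω) : CoherentConfiguration Ω :=
  CoherentConfiguration.coherentClosure {edgeRel X}

/-- `WL_m`-equivalence of graphs (`m ≥ 2`): there is an algebraic isomorphism
`ψ : WL_m(WL(X)) → WL_m(WL(X'))` with `ψ₂(E(X)) = E(X')`. -/
def WLEquivalent {Ω Ω' : Type*} [Finite Ω] [Finite Ω'] (m : ℕ) (hm : 2 ≤ m)
    (X : SimpleGraph Ω) (X' : SimpleGraph Ω') : Prop :=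
  ∃ ψ : MAryAlgIso (WLm m (WL X)) (WLm m (WL X')), ψ.map2 hm (edgeRel X) = edgeRel X'

/-- The cylindrical relation `cyl_s(i, j) = {(x, y) : (x_i, y_j) ∈ s}` on `Ω × Ω`; the two
coordinates of a pair are indexed by `0` and `1`. -/
def cyl {Ω : Type*} (s : Set (Ω × Ω)) (i j : Fin 2) : Set ((Ω × Ω) × (Ω × Ω)) :=
  {p | (![p.1.1, p.1.2] i, ![p.2.1, p.2.2] j) ∈ s}

/-! Colour an `m`-tuple over `Ω` by the image under `ψ` of its class, and an `m`-tuple over `Ω'` by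
its class. With this common palette, an algebraic isomorphism of `WL_m` configurations becomes a
back-and-forth property (`TupleMatching`): tuples of equal colour remain so under reindexing and
under one-point replacements matched by a bijection `Ω ≃ Ω'`. Padding by repetition reduces to
`6`-tuples, which colour both pairs of points and pairs of pairs. Six coordinates suffice: four for
a pair of pairs and two for the intermediate point of `Ω²` counted by an intersection number. Both
induced colourings are `PairMatching`s.

The main engine is `PairMatching.exists_algIso`. If generating sets `R`, `R'` match colour by
colour, then `WL(R')` pulls back to a coherent configuration having `R` as relations, so minimality
makes every relation of `WL(R)` match one of `WL(R')`, and symmetrically. On pairs, with the edge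
sets as generators, this yields `φ`; on pairs of pairs, with tensor relations and `1_Δ`, it yields
`φhat`.

The colour of a quadruple determines the colours of its pairs, so `cyl_s` matches `cyl_{φ(s)}`. A
set has at most one matching partner, which forces the required equality. -/

/-! ### Matched colourings of tuples and pairs. -/

/-- `TupleMatching C C'`: the colourings `C` and `C'` of `n`-tuples use the same colours, and
tuples of the same colour have the same equality type, equally coloured reindexings, and
one-point replacements that are matched by a bijection. -/
structure TupleMatching {Ω Ω' K : Type*} {n : ℕ} (C : (Fin n → Ω) → K)
    (C' : (Fin n → Ω') → K) : Prop where
  left : ∀ x, ∃ x', C x = C' x'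
  right : ∀ x', ∃ x, C x = C' x'
  eq_iff : ∀ x x', C x = C' x' → ∀ i j, x i = x j ↔ x' i = x' j
  comp : ∀ x x', C x = C' x' → ∀ σ : Fin n → Fin n, C (x ∘ σ) = C' (x' ∘ σ)
  extend : ∀ x x', C x = C' x' → ∃ π : Ω ≃ Ω', ∀ α i,
    C (Function.update x i α) = C' (Function.update x' i (π α))

/-- `PairMatching c c'`: the colourings `c` and `c'` of pairs use the same colours, and the colour
classes match as the basis relations of algebraically isomorphic coherent configurations. -/
structure PairMatching {Ω Ω' K : Type*} (c : Ω × Ω → K) (c' : Ω' × Ω' → K) : Prop where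
  left : ∀ p, ∃ p', c p = c' p'
  right : ∀ p', ∃ p, c p = c' p'
  diag : ∀ p p', c p = c' p' → (p.1 = p.2 ↔ p'.1 = p'.2)
  swap : ∀ p p', c p = c' p' → c (p.2, p.1) = c' (p'.2, p'.1)
  extend : ∀ p p', c p = c' p' → ∃ π : Ω ≃ Ω', ∀ γ,
    c (p.1, γ) = c' (p'.1, π γ) ∧ c (γ, p.2) = c' (π γ, p'.2)

/-- The sets `r` and `r'` contain elements of the same colours. -/
def Matches {A A' K : Type*} (c : A → K) (c' : A' → K) (r : Set A) (r' : Set A') : Prop :=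
  ∀ p p', c p = c' p' → (p ∈ r ↔ p' ∈ r')

/-- The set of elements whose colour occurs in `r`. -/
def colorImage {A A' K : Type*} (c : A → K) (c' : A' → K) (r : Set A) : Set A' :=
  {p' | ∃ p ∈ r, c p = c' p'}

theorem Matches.symm {A A' K : Type*} {c : A → K} {c' : A' → K} {r : Set A} {r' : Set A'}
    (h : Matches c c' r r') : Matches c' c r' r :=
  fun p' p e => (h p p' e.symm).symm

theorem matches_colorImage {A A' K : Type*} {c : A → K} {c' : A' → K} {r : Set A}
    (hr : ∀ p q, c p = c q → p ∈ r → q ∈ r) : Matches c c' r (colorImage c c' r) := by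
  intro p p' e
  constructor
  · exact fun hp => ⟨p, hp, e⟩
  · rintro ⟨q, hq, e'⟩
    exact hr q p (e'.trans e.symm) hq

/-! ### Coherent closures of matched generating sets. -/

namespace PairMatching

variable {Ω Ω' K : Type*} {c : Ω × Ω → K} {c' : Ω' × Ω' → K}

theorem symm (h : PairMatching c c') : PairMatching c' c where
  left p := (h.right p).imp fun _ e => e.symm
  right p := (h.left p).imp fun _ e => e.symm
  diag p p' e := (h.diag p' p e.symm).symm
  swap p p' e := (h.swap p' p e.symm).symm
  extend p p' e := by
    obtain ⟨π, hπ⟩ := h.extend p' p e.symm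
    refine ⟨π.symm, fun γ => ?_⟩
    have := hπ (π.symm γ)
    rw [Equiv.apply_symm_apply] at this
    exact ⟨this.1.symm, this.2.symm⟩

/-- Pass to the other side and return: two pairs of equal colour share a partner `p'`. This is what
makes the colour classes on one side a coherent configuration. -/
theorem self (h : PairMatching c c') : PairMatching c c where
  left p := ⟨p, rfl⟩
  right p := ⟨p, rfl⟩
  diag p q e := by
    obtain ⟨p', hp'⟩ := h.left p
    exact (h.diag p p' hp').trans (h.diag q p' (e.symm.trans hp')).symm
  swap p q e := by
    obtain ⟨p', hp'⟩ := h.left p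
    exact (h.swap p p' hp').trans (h.swap q p' (e.symm.trans hp')).symm
  extend p q e := by
    obtain ⟨p', hp'⟩ := h.left p
    obtain ⟨π, hπ⟩ := h.extend p p' hp'
    obtain ⟨τ, hτ⟩ := h.extend q p' (e.symm.trans hp')
    refine ⟨π.trans τ.symm, fun γ => ?_⟩
    have := hτ (τ.symm (π γ))
    rw [Equiv.apply_symm_apply] at this
    exact ⟨(hπ γ).1.trans this.1.symm, (hπ γ).2.trans this.2.symm⟩

/-- Every colour on the right also occurs on the left. All identities between images of relations
are eventually deduced from this uniqueness. -/
theorem matches_right_unique (h : PairMatching c c') {r : Set (Ω × Ω)} {r₁ r₂ : Set (Ω' × Ω')}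
    (h₁ : Matches c c' r r₁) (h₂ : Matches c c' r r₂) : r₁ = r₂ := by
  ext p'
  obtain ⟨p, hp⟩ := h.right p'
  exact (h₁ p p' hp).symm.trans (h₂ p p' hp)

theorem matches_left_unique (h : PairMatching c c') {r₁ r₂ : Set (Ω × Ω)} {r : Set (Ω' × Ω')}
    (h₁ : Matches c c' r₁ r) (h₂ : Matches c c' r₂ r) : r₁ = r₂ :=
  h.symm.matches_right_unique h₁.symm h₂.symm

theorem pathCount_eq (h : PairMatching c c') {r s : Set (Ω × Ω)} {r' s' : Set (Ω' × Ω')}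
    (hr : Matches c c' r r') (hs : Matches c c' s s') {p : Ω × Ω} {p' : Ω' × Ω'}
    (e : c p = c' p') : pathCount r s p = pathCount r' s' p' := by
  obtain ⟨π, hπ⟩ := h.extend p p' e
  have hmem : ∀ γ, ((p.1, γ) ∈ r ∧ (γ, p.2) ∈ s) ↔ ((p'.1, π γ) ∈ r' ∧ (π γ, p'.2) ∈ s') :=
    fun γ => and_congr (hr _ _ (hπ γ).1) (hs _ _ (hπ γ).2)
  unfold pathCount
  refine Set.ncard_congr (fun γ _ => π γ) ?_ ?_ ?_
  · exact fun γ hγ => (hmem γ).1 hγ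
  · exact fun a b _ _ hab => π.injective hab
  · exact fun b hb => ⟨π.symm b, (hmem _).2 (by simpa using hb), by simp⟩

/-- The coherent configuration whose basis relations are the colour classes. -/
def config (h : PairMatching c c) : CoherentConfiguration Ω where
  S := (Setoid.ker c).classes
  isPartition := Setoid.isPartition_classes _
  diag_mem := by
    rw [mem_classUnions_iff (Setoid.isPartition_classes _)]
    rintro t ⟨y, rfl⟩ p hp q hq hpd
    exact (h.diag p q (Eq.trans hp (Eq.symm hq))).1 hpd
  converse_mem := by
    rintro s ⟨y, rfl⟩
    refine ⟨(y.2, y.1), ?_⟩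
    ext p
    exact ⟨fun e => h.swap _ _ e, fun e => h.swap _ _ e⟩
  pathCount_eq := by
    rintro _ ⟨a, rfl⟩ _ ⟨b, rfl⟩ _ ⟨y, rfl⟩ p hp q hq
    refine h.pathCount_eq ?_ ?_ (Eq.trans hp (Eq.symm hq))
    · intro u v e
      exact ⟨fun hu => Eq.trans (Eq.symm e) hu, fun hv => Eq.trans e hv⟩
    · intro u v e
      exact ⟨fun hu => Eq.trans (Eq.symm e) hu, fun hv => Eq.trans e hv⟩

theorem mem_config_relations (h : PairMatching c c) {r : Set (Ω × Ω)} :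
    r ∈ h.config.relations ↔ ∀ p q, c p = c q → p ∈ r → q ∈ r := by
  rw [CoherentConfiguration.mem_relations_iff]
  constructor
  · exact fun hr p q e hp => hr _ ((Setoid.ker c).mem_classes q) p e q rfl hp
  · rintro hr t ⟨y, rfl⟩ p hp q hq
    exact hr p q (Eq.trans hp (Eq.symm hq))

/-- The coherent configuration whose basis relations match those of `D`, provided that the
relations of `D` are unions of colour classes. -/
def pullback (h : PairMatching c c') (D : CoherentConfiguration Ω')
    (hD : ∀ s ∈ D.S, ∀ p q, c' p = c' q → p ∈ s → q ∈ s) : CoherentConfiguration Ω :=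
  have part : Setoid.IsPartition {r : Set (Ω × Ω) | ∃ s ∈ D.S, Matches c c' r s} := by
    constructor
    · rintro ⟨s, hs, hm⟩
      obtain ⟨p', hp'⟩ := Setoid.nonempty_of_mem_partition D.isPartition hs
      obtain ⟨p, hp⟩ := h.right p'
      exact (hm p p' hp).2 hp'
    · intro p
      obtain ⟨p', hp'⟩ := h.left p
      obtain ⟨s, ⟨hs, hps⟩, hu⟩ := D.isPartition.2 p'
      have hm : Matches c c' (colorImage c' c s) s :=
        (matches_colorImage (c' := c) (hD s hs)).symm
      refine ⟨colorImage c' c s, ⟨⟨s, hs, hm⟩, ⟨p', hps, hp'.symm⟩⟩, ?_⟩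
      rintro r ⟨⟨t, ht, hrt⟩, hpr⟩
      obtain rfl := hu t ⟨ht, (hrt p p' hp').1 hpr⟩
      exact h.matches_left_unique hrt hm
  { S := {r | ∃ s ∈ D.S, Matches c c' r s}
    isPartition := part
    diag_mem := by
      rw [mem_classUnions_iff part]
      rintro t ⟨t', ht', hm⟩ p hp q hq hpd
      obtain ⟨p', hp'⟩ := h.left p
      obtain ⟨q', hq'⟩ := h.left q
      exact (h.diag q q' hq').2 (D.mem_relations_iff.1 D.diag_mem t' ht' p' ((hm p p' hp').1 hp)
        q' ((hm q q' hq').1 hq) ((h.diag p p' hp').1 hpd))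
    converse_mem := by
      rintro s ⟨s', hs', hm⟩
      exact ⟨_, D.converse_mem s' hs', fun p p' e => hm _ _ (h.swap p p' e)⟩
    pathCount_eq := by
      rintro r ⟨r', hr', hr⟩ s ⟨s', hs', hs⟩ t ⟨t', ht', ht⟩ p hp q hq
      obtain ⟨p', hp'⟩ := h.left p
      obtain ⟨q', hq'⟩ := h.left q
      rw [h.pathCount_eq hr hs hp', h.pathCount_eq hr hs hq']
      exact D.pathCount_eq r' hr' s' hs' t' ht' p' ((ht p p' hp').1 hp) q' ((ht q q' hq').1 hq) }

theorem mem_pullback_relations (h : PairMatching c c') {D : CoherentConfiguration Ω'}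
    (hD : ∀ s ∈ D.S, ∀ p q, c' p = c' q → p ∈ s → q ∈ s) {r : Set (Ω × Ω)} {r' : Set (Ω' × Ω')}
    (hr : Matches c c' r r') : r ∈ (h.pullback D hD).relations ↔ r' ∈ D.relations := by
  rw [CoherentConfiguration.mem_relations_iff, CoherentConfiguration.mem_relations_iff]
  constructor
  · intro H t' ht' p' hp' q' hq' hpr
    obtain ⟨p, hp⟩ := h.right p'
    obtain ⟨q, hq⟩ := h.right q'
    exact (hr q q' hq).1 (H _ ⟨t', ht', (matches_colorImage (c' := c) (hD t' ht')).symm⟩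
      p ⟨p', hp', hp.symm⟩ q ⟨q', hq', hq.symm⟩ ((hr p p' hp).2 hpr))
  · rintro H t ⟨t', ht', ht⟩ p hp q hq hpr
    obtain ⟨p', hp'⟩ := h.left p
    obtain ⟨q', hq'⟩ := h.left q
    exact (hr q q' hq').2 (H t' ht' p' ((ht p p' hp').1 hp) q' ((ht q q' hq').1 hq)
      ((hr p p' hp').1 hpr))

open CoherentConfiguration

/-- The colour classes form a coherent configuration having the members of `R` as relations, so it
refines the closure. -/
theorem coherentClosure_saturated [Finite Ω] (h : PairMatching c c') {R : Set (Set (Ω × Ω))}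
    {R' : Set (Set (Ω' × Ω'))} (hR : ∀ u ∈ R, ∃ u' ∈ R', Matches c c' u u')
    {r : Set (Ω × Ω)} (hr : r ∈ (coherentClosure R).relations) :
    ∀ p q, c p = c q → p ∈ r → q ∈ r := by
  rw [mem_coherentClosure_relations] at hr
  refine h.self.mem_config_relations.1 (hr _ fun u hu => h.self.mem_config_relations.2 ?_)
  intro p q e hp
  obtain ⟨u', -, hm⟩ := hR u hu
  obtain ⟨p', hp'⟩ := h.left p
  exact (hm q p' (e.symm.trans hp')).2 ((hm p p' hp').1 hp)

/-- The pullback of `coherentClosure R'` has the members of `R` as relations, hence, by minimality,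
also `r`; the colour image of `r` is then a relation on the other side. -/
theorem exists_matching_relation [Finite Ω] [Finite Ω'] (h : PairMatching c c')
    {R : Set (Set (Ω × Ω))} {R' : Set (Set (Ω' × Ω'))}
    (hR : ∀ u ∈ R, ∃ u' ∈ R', Matches c c' u u') (hR' : ∀ u' ∈ R', ∃ u ∈ R, Matches c c' u u')
    {r : Set (Ω × Ω)} (hr : r ∈ (coherentClosure R).relations) :
    ∃ r' ∈ (coherentClosure R').relations, Matches c c' r r' := by
  have hm : Matches c c' r (colorImage c c' r) :=
    matches_colorImage (h.coherentClosure_saturated hR hr)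
  have hD : ∀ s ∈ (coherentClosure R').S, ∀ p q, c' p = c' q → p ∈ s → q ∈ s := fun s hs =>
    h.symm.coherentClosure_saturated (fun u' hu' => (hR' u' hu').imp fun u hu => ⟨hu.1, hu.2.symm⟩)
      (mem_classUnions_of_mem hs)
  refine ⟨_, (h.mem_pullback_relations hD hm).1 ?_, hm⟩
  rw [mem_coherentClosure_relations] at hr
  refine hr _ fun u hu => ?_
  obtain ⟨u', hu', huu'⟩ := hR u hu
  exact (h.mem_pullback_relations hD huu').2 ((coherentClosure_isLeast R').1 u' hu')

theorem exists_matching_class [Finite Ω] [Finite Ω'] (h : PairMatching c c')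
    {R : Set (Set (Ω × Ω))} {R' : Set (Set (Ω' × Ω'))}
    (hR : ∀ u ∈ R, ∃ u' ∈ R', Matches c c' u u') (hR' : ∀ u' ∈ R', ∃ u ∈ R, Matches c c' u u')
    {t : Set (Ω × Ω)} (ht : t ∈ (coherentClosure R).S) :
    ∃ t' ∈ (coherentClosure R').S, Matches c c' t t' := by
  obtain ⟨t', ht', hm⟩ := h.exists_matching_relation hR hR' (mem_classUnions_of_mem ht)
  refine ⟨t', ?_, hm⟩
  obtain ⟨p, hp⟩ := Setoid.nonempty_of_mem_partition (coherentClosure R).isPartition ht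
  obtain ⟨p', hp'⟩ := h.left p
  obtain ⟨u', ⟨hu', hpu'⟩, -⟩ := (coherentClosure R').isPartition.2 p'
  -- A priori `t'` is only a union of classes. A class `u'` inside it matches a relation `u` meeting
  -- the class `t`; so `u` contains `t`, and `u'` contains `t'`.
  obtain ⟨u, hu, hum⟩ := h.symm.exists_matching_relation
    (fun u' hu' => (hR' u' hu').imp fun u hu => ⟨hu.1, hu.2.symm⟩)
    (fun u hu => (hR u hu).imp fun u' hu' => ⟨hu'.1, hu'.2.symm⟩) (mem_classUnions_of_mem hu')
  rw [mem_relations_iff] at hu ht'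
  have hut : u' = t' := by
    ext q'
    obtain ⟨q, hq⟩ := h.right q'
    constructor
    · exact fun hq' => ht' u' hu' p' hpu' q' hq' ((hm p p' hp').1 hp)
    · intro hq'
      exact (hum q' q hq.symm).2 (hu t ht p hp q ((hm q q' hq).2 hq')
        ((hum p' p hp'.symm).1 hpu'))
  rwa [← hut]

theorem exists_algIso [Finite Ω] [Finite Ω'] (h : PairMatching c c')
    {R : Set (Set (Ω × Ω))} {R' : Set (Set (Ω' × Ω'))}
    (hR : ∀ u ∈ R, ∃ u' ∈ R', Matches c c' u u') (hR' : ∀ u' ∈ R', ∃ u ∈ R, Matches c c' u u') :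
    ∃ φ : AlgIso (coherentClosure R) (coherentClosure R'),
      (∀ t, Matches c c' t.1 (φ.toEquiv t).1) ∧
      ∀ r ∈ (coherentClosure R).relations, Matches c c' r (φ.map r) := by
  choose f hfS hf using fun t : (coherentClosure R).S => h.exists_matching_class hR hR' t.2
  let F : (coherentClosure R).S → (coherentClosure R').S := fun t => ⟨f t, hfS t⟩
  have hF : Function.Bijective F := by
    constructor
    · intro s t e
      have e' : f s = f t := congrArg Subtype.val e
      exact Subtype.ext (h.matches_left_unique (hf s) (e' ▸ hf t))
    · intro t'
      obtain ⟨t, ht, hm⟩ := h.symm.exists_matching_class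
        (fun u' hu' => (hR' u' hu').imp fun u hu => ⟨hu.1, hu.2.symm⟩)
        (fun u hu => (hR u hu).imp fun u' hu' => ⟨hu'.1, hu'.2.symm⟩) t'.2
      exact ⟨⟨t, ht⟩, Subtype.ext (h.matches_right_unique (hf ⟨t, ht⟩) hm.symm)⟩
  refine ⟨⟨Equiv.ofBijective F hF, ?_⟩, hf, ?_⟩
  · intro r s t p hp p' hp'
    -- `p'` need not have the colour of `p`. The counts are compared at a partner `q'` of `p` and
    -- moved to `p'` inside the image class.
    obtain ⟨q', hq'⟩ := h.left p
    rw [h.pathCount_eq (hf r) (hf s) hq']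
    exact (coherentClosure R').pathCount_eq _ (hfS r) _ (hfS s) _ (hfS t) p' hp' q'
      ((hf t p q' hq').1 hp)
  · intro r hr p p' e
    constructor
    · intro hp
      obtain ⟨t, ⟨ht, hpt⟩, -⟩ := (coherentClosure R).isPartition.2 p
      exact ⟨⟨t, ht⟩, fun q hq => (mem_relations_iff _).1 hr t ht p hpt q hq hp,
        (hf ⟨t, ht⟩ p p' e).1 hpt⟩
    · rintro ⟨t, htr, hp'⟩
      exact htr ((hf t p p' e).2 hp')

end PairMatching

/-! ### From tuples to pairs and to pairs of pairs. -/

namespace TupleMatching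

variable {Ω Ω' K : Type*}

/-- Here `τ` pads a short tuple by repetitions. A one-point replacement in the padded tuple spoils
the padding, and reindexing by `ι ∘ τ` restores it. -/
theorem update_comp_leftInverse {A : Type*} {m n : ℕ} {ι : Fin n → Fin m} {τ : Fin m → Fin n}
    (hι : ∀ i, τ (ι i) = i) (v : Fin n → A) (i : Fin n) (a : A) :
    Function.update (v ∘ τ) (ι i) a ∘ (ι ∘ τ) = Function.update v i a ∘ τ := by
  have hι' : Function.Injective ι := Function.LeftInverse.injective hι
  funext k
  simp [Function.update_apply, hι, hι'.eq_iff]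

theorem comp_leftInverse {A : Type*} {m n : ℕ} {ι : Fin n → Fin m} {τ : Fin m → Fin n}
    (hι : ∀ i, τ (ι i) = i) (v : Fin n → A) (σ : Fin n → Fin n) :
    (v ∘ τ) ∘ (ι ∘ σ ∘ τ) = (v ∘ σ) ∘ τ := by
  funext i
  simp [hι]

/-- Colourings of long tuples induce colourings of shorter ones. -/
theorem shorten {m n : ℕ} {C : (Fin m → Ω) → K} {C' : (Fin m → Ω') → K}
    (h : TupleMatching C C') (ι : Fin n → Fin m) (τ : Fin m → Fin n) (hι : ∀ i, τ (ι i) = i) :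
    TupleMatching (fun v => C (v ∘ τ)) (fun v => C' (v ∘ τ)) where
  left v := by
    obtain ⟨x', hx'⟩ := h.left (v ∘ τ)
    -- The partner `x'` need not be padded; this reindexing makes it so and fixes `v ∘ τ`.
    have := h.comp _ _ hx' (ι ∘ id ∘ τ)
    rw [comp_leftInverse hι] at this
    exact ⟨x' ∘ ι, this⟩
  right v' := by
    obtain ⟨x, hx⟩ := h.right (v' ∘ τ)
    have := h.comp _ _ hx (ι ∘ id ∘ τ)
    rw [comp_leftInverse hι] at this
    exact ⟨x ∘ ι, this⟩
  eq_iff v v' e i j := by simpa [hι] using h.eq_iff _ _ e (ι i) (ι j)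
  comp v v' e σ := by
    have := h.comp _ _ e (ι ∘ σ ∘ τ)
    rwa [comp_leftInverse hι, comp_leftInverse hι] at this
  extend v v' e := by
    obtain ⟨π, hπ⟩ := h.extend _ _ e
    refine ⟨π, fun α i => ?_⟩
    have := h.comp _ _ (hπ α (ι i)) (ι ∘ τ)
    rwa [update_comp_leftInverse hι, update_comp_leftInverse hι] at this

variable {C : (Fin 6 → Ω) → K} {C' : (Fin 6 → Ω') → K}

/-- The pair `(a, b)` as a `6`-tuple. -/
def pairTuple {A : Type*} (p : A × A) : Fin 6 → A := ![p.1, p.2, p.2, p.2, p.2, p.2]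

/-- The pair `((a, b), (c, d))` of pairs as a `6`-tuple. -/
def quadTuple {A : Type*} (p : (A × A) × (A × A)) : Fin 6 → A :=
  ![p.1.1, p.1.2, p.2.1, p.2.2, p.2.2, p.2.2]

theorem comp_vec6 {A : Type*} (x : Fin 6 → A) (i₀ i₁ i₂ i₃ i₄ i₅ : Fin 6) :
    x ∘ ![i₀, i₁, i₂, i₃, i₄, i₅] = ![x i₀, x i₁, x i₂, x i₃, x i₄, x i₅] := by
  funext k
  fin_cases k <;> rfl

theorem pair_of_eq (h : TupleMatching C C') {x : Fin 6 → Ω} {x' : Fin 6 → Ω'}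
    (e : C x = C' x') (i j : Fin 6) :
    C (pairTuple (x i, x j)) = C' (pairTuple (x' i, x' j)) := by
  have := h.comp _ _ e ![i, j, j, j, j, j]
  rwa [comp_vec6, comp_vec6] at this

theorem quad_of_eq (h : TupleMatching C C') {x : Fin 6 → Ω} {x' : Fin 6 → Ω'}
    (e : C x = C' x') (i j k l : Fin 6) :
    C (quadTuple ((x i, x j), (x k, x l))) = C' (quadTuple ((x' i, x' j), (x' k, x' l))) := by
  have := h.comp _ _ e ![i, j, k, l, l, l]
  rwa [comp_vec6, comp_vec6] at this

theorem pairMatching (h : TupleMatching C C') :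
    PairMatching (fun p => C (pairTuple p)) (fun p => C' (pairTuple p)) where
  left p := by
    obtain ⟨x', hx'⟩ := h.left (pairTuple p)
    exact ⟨(x' 0, x' 1), h.pair_of_eq hx' 0 1⟩
  right p' := by
    obtain ⟨x, hx⟩ := h.right (pairTuple p')
    exact ⟨(x 0, x 1), h.pair_of_eq hx 0 1⟩
  diag p p' e := h.eq_iff _ _ e 0 1
  swap p p' e := h.pair_of_eq e 1 0
  extend p p' e := by
    obtain ⟨π, hπ⟩ := h.extend _ _ e
    -- Coordinate `2` is spare, so one replacement records both `(p.1, γ)` and `(γ, p.2)`.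
    exact ⟨π, fun γ => ⟨h.pair_of_eq (hπ γ 2) 0 2, h.pair_of_eq (hπ γ 2) 2 1⟩⟩

theorem quadMatching (h : TupleMatching C C') :
    PairMatching (fun p => C (quadTuple p)) (fun p => C' (quadTuple p)) where
  left p := by
    obtain ⟨x', hx'⟩ := h.left (quadTuple p)
    exact ⟨((x' 0, x' 1), (x' 2, x' 3)), h.quad_of_eq hx' 0 1 2 3⟩
  right p' := by
    obtain ⟨x, hx⟩ := h.right (quadTuple p')
    exact ⟨((x 0, x 1), (x 2, x 3)), h.quad_of_eq hx 0 1 2 3⟩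
  diag p p' e := by
    rw [Prod.ext_iff, Prod.ext_iff]
    exact and_congr (h.eq_iff _ _ e 0 2) (h.eq_iff _ _ e 1 3)
  swap p p' e := h.quad_of_eq e 2 3 0 1
  extend p p' e := by
    obtain ⟨π, hπ⟩ := h.extend _ _ e
    -- The intermediate pair is placed in coordinates `4` and `5`, leaving `0` to `3` intact. The
    -- bijection for its second entry depends on the first entry, hence a sheared product.
    choose τ hτ using fun γ => h.extend _ _ (hπ γ 4)
    refine ⟨Equiv.prodShear π τ, fun γ => ⟨?_, ?_⟩⟩
    · exact h.quad_of_eq (hτ γ.1 γ.2 5) 0 1 4 5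
    · exact h.quad_of_eq (hτ γ.1 γ.2 5) 4 5 2 3

theorem pair_of_quad_eq (h : TupleMatching C C') {p : (Ω × Ω) × (Ω × Ω)}
    {p' : (Ω' × Ω') × (Ω' × Ω')} (e : C (quadTuple p) = C' (quadTuple p')) (i j : Fin 2) :
    C (pairTuple (![p.1.1, p.1.2] i, ![p.2.1, p.2.2] j)) =
      C' (pairTuple (![p'.1.1, p'.1.2] i, ![p'.2.1, p'.2.2] j)) := by
  fin_cases i <;> fin_cases j
  · exact h.pair_of_eq e 0 2
  · exact h.pair_of_eq e 0 3
  · exact h.pair_of_eq e 1 2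
  · exact h.pair_of_eq e 1 3

end TupleMatching

/-! ### Cylinders are relations of the 2-extension. -/

namespace CoherentConfiguration

variable {Ω : Type*}

/-- The composite is the set where `pathCount` is nonzero, and `pathCount` is constant on classes.
-/
theorem relations_comp [Finite Ω] (D : CoherentConfiguration Ω) {r s : Set (Ω × Ω)}
    (hr : r ∈ D.relations) (hs : s ∈ D.relations) :
    {p : Ω × Ω | ∃ γ, (p.1, γ) ∈ r ∧ (γ, p.2) ∈ s} ∈ D.relations := by
  have key : ∀ p : Ω × Ω, (∃ γ, (p.1, γ) ∈ r ∧ (γ, p.2) ∈ s) ↔ pathCount r s p ≠ 0 := by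
    intro p
    rw [pathCount, ← Nat.pos_iff_ne_zero, Set.ncard_pos]
    rfl
  rw [mem_relations_iff]
  intro t ht p hp q hq h
  have h' := (key p).1 h
  rw [D.pathCount_eq_of_relations hr hs ht hp hq] at h'
  exact (key q).2 h'

theorem relTensor_mem_twoExtension [Finite Ω] (C : CoherentConfiguration Ω)
    {r s : Set (Ω × Ω)} (hr : r ∈ C.relations) (hs : s ∈ C.relations) :
    relTensor r s ∈ C.twoExtension.relations := by
  have hT : ∀ u ∈ (C.tensor C).S, u ∈ C.twoExtension.relations := fun u hu =>
    (coherentClosure_isLeast _).1 u (Or.inl hu)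
  rw [mem_relations_iff] at hr hs ⊢
  intro t ht p hp q hq h
  obtain ⟨a, ⟨ha, hpa⟩, -⟩ := C.isPartition.2 (p.1.1, p.2.1)
  obtain ⟨b, ⟨hb, hpb⟩, -⟩ := C.isPartition.2 (p.1.2, p.2.2)
  have hq' : q ∈ relTensor a b :=
    (mem_relations_iff _).1 (hT _ ⟨a, ha, b, hb, rfl⟩) t ht p hp q hq ⟨hpa, hpb⟩
  exact ⟨hr a ha _ hpa _ hq'.1 h.1, hs b hb _ hpb _ hq'.2 h.2⟩

theorem univ_mem_relations (C : CoherentConfiguration Ω) : Set.univ ∈ C.relations := by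
  rw [mem_relations_iff]
  exact fun _ _ _ _ _ _ _ => trivial

theorem cyl_mem_twoExtension [Finite Ω] (C : CoherentConfiguration Ω) {s : Set (Ω × Ω)}
    (hs : s ∈ C.relations) (i j : Fin 2) : cyl s i j ∈ C.twoExtension.relations := by
  have hΔ : {p : (Ω × Ω) × (Ω × Ω) | p.1 = p.2 ∧ p.1.1 = p.1.2} ∈ C.twoExtension.relations :=
    (coherentClosure_isLeast _).1 _ (Or.inr rfl)
  have h0 : relTensor s Set.univ ∈ C.twoExtension.relations :=
    C.relTensor_mem_twoExtension hs C.univ_mem_relations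
  have h1 : relTensor Set.univ s ∈ C.twoExtension.relations :=
    C.relTensor_mem_twoExtension C.univ_mem_relations hs
  have d0 : relTensor {p : Ω × Ω | p.1 = p.2} Set.univ ∈ C.twoExtension.relations :=
    C.relTensor_mem_twoExtension C.diag_mem C.univ_mem_relations
  have d1 : relTensor Set.univ {p : Ω × Ω | p.1 = p.2} ∈ C.twoExtension.relations :=
    C.relTensor_mem_twoExtension C.univ_mem_relations C.diag_mem
  fin_cases i <;> fin_cases j
  · convert h0 using 1
    ext p
    simp [cyl, relTensor]
  -- The path runs from `x` to `(y₂, y₂)` with `(x₁, y₂) ∈ s`, stays there by `1_Δ`, then goes to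
  -- `y`, keeping the second entry: the diagonal carries a value from one coordinate to the other.
  · convert relations_comp _ h0 (relations_comp _ hΔ d1) using 1
    ext p
    simp [cyl, relTensor]
  · convert relations_comp _ h1 (relations_comp _ hΔ d0) using 1
    ext p
    simp [cyl, relTensor]
  · convert h1 using 1
    ext p
    simp [cyl, relTensor]

end CoherentConfiguration

/-! ### Tuple matchings from algebraic isomorphisms of `m`-ary configurations. -/

/-- Bijections between equal-sized fibres are glued together. This turns equality of intersection
numbers into a single bijection of points. -/
theorem exists_equiv_of_ncard_fiber_eq {A B L : Type*} [Finite A] [Finite B] (f : A → L)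
    (g : B → L) (h : ∀ l, {a | f a = l}.ncard = {b | g b = l}.ncard) :
    ∃ π : A ≃ B, ∀ a, f a = g (π a) := by
  have e : ∀ l, Nonempty ({a // f a = l} ≃ {b // g b = l}) := fun l =>
    Finite.card_eq.1 (h l)
  refine ⟨(Equiv.sigmaFiberEquiv f).symm.trans
    ((Equiv.sigmaCongrRight fun l => (e l).some).trans (Equiv.sigmaFiberEquiv g)), fun a => ?_⟩
  exact ((e (f a)).some ⟨a, rfl⟩).2.symm

namespace MAryCoherentConfiguration

variable {m : ℕ} {Ω : Type*}

theorem exists_class (C : MAryCoherentConfiguration m Ω) (x : Fin m → Ω) :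
    ∃ Λ : C.S, x ∈ Λ.1 := by
  obtain ⟨Λ, ⟨h, hx⟩, -⟩ := C.isPartition.2 x
  exact ⟨⟨Λ, h⟩, hx⟩

/-- The class of a tuple. -/
noncomputable def cls (C : MAryCoherentConfiguration m Ω) (x : Fin m → Ω) : C.S :=
  (C.exists_class x).choose

theorem mem_cls (C : MAryCoherentConfiguration m Ω) (x : Fin m → Ω) : x ∈ (C.cls x).1 :=
  (C.exists_class x).choose_spec

theorem cls_eq_iff (C : MAryCoherentConfiguration m Ω) {x : Fin m → Ω} {Λ : C.S} :
    C.cls x = Λ ↔ x ∈ Λ.1 := by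
  constructor
  · rintro rfl
    exact C.mem_cls x
  · exact fun h => Subtype.ext ((C.isPartition.2 x).unique ⟨(C.cls x).2, C.mem_cls x⟩ ⟨Λ.2, h⟩)

theorem cls_comp (C : MAryCoherentConfiguration m Ω) (x : Fin m → Ω) (σ : Fin m → Fin m) :
    C.cls (x ∘ σ) = ⟨tupleReindex σ (C.cls x).1, C.reindex_mem σ _ (C.cls x).2⟩ :=
  C.cls_eq_iff.2 ⟨x, C.mem_cls x, rfl⟩

end MAryCoherentConfiguration

theorem MAryAlgIso.tupleMatching {m : ℕ} {Ω Ω' : Type*} [Finite Ω] [Finite Ω']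
    {C : MAryCoherentConfiguration m Ω} {C' : MAryCoherentConfiguration m Ω'}
    (ψ : MAryAlgIso C C') : TupleMatching (fun x => ψ.toEquiv (C.cls x)) C'.cls where
  left x := by
    obtain ⟨x', hx'⟩ := Setoid.nonempty_of_mem_partition C'.isPartition (ψ.toEquiv (C.cls x)).2
    exact ⟨x', (C'.cls_eq_iff.2 hx').symm⟩
  right x' := by
    obtain ⟨x, hx⟩ :=
      Setoid.nonempty_of_mem_partition C.isPartition (ψ.toEquiv.symm (C'.cls x')).2
    exact ⟨x, by rw [C.cls_eq_iff.2 hx, Equiv.apply_symm_apply]⟩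
  eq_iff x x' e := ψ.map_eq_iff _ x (C.mem_cls x) x' (C'.cls_eq_iff.1 e.symm)
  comp x x' e σ := by
    refine Subtype.ext ?_
    simp only [C.cls_comp, C'.cls_comp, ψ.map_reindex, e]
  extend x x' e := by
    suffices H : ∃ π : Ω ≃ Ω', ∀ α, (fun i => ψ.toEquiv (C.cls (Function.update x i α))) =
        fun i => C'.cls (Function.update x' i (π α)) from
      H.imp fun π hπ α i => congrFun (hπ α) i
    refine exists_equiv_of_ncard_fiber_eq
      (fun α i => ψ.toEquiv (C.cls (Function.update x i α)))
      (fun α i => C'.cls (Function.update x' i α)) fun l => ?_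
    -- The fibre over a family `l` of classes is counted by the intersection number of the family
    -- `ψ⁻¹(l i)`.
    have := ψ.map_substCount (fun i => ψ.toEquiv.symm (l i)) (C.cls x) x (C.mem_cls x) x'
      (C'.cls_eq_iff.1 e.symm)
    simp only [Equiv.apply_symm_apply, substCount] at this
    convert this.symm using 2
    · ext α
      simp only [Set.mem_ofPred_eq, funext_iff, ← C.cls_eq_iff, Equiv.eq_symm_apply]
    · ext α
      simp only [Set.mem_ofPred_eq, funext_iff, ← C'.cls_eq_iff]

/-! ### Edges and colours of tuples. -/

/-- Whether a pair is an edge is determined by the `WL_m`-class of any tuple beginning with it. -/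
theorem adj_iff_of_stable {Ω : Type*} [Finite Ω] {m : ℕ} {X : SimpleGraph Ω} {x y : Fin m → Ω}
    (h : WeisfeilerLeman.stable m (WL X) x y) (i j : Fin m) :
    X.Adj (x i) (x j) ↔ X.Adj (y i) (y j) := by
  obtain ⟨s, ⟨hs, hx⟩, -⟩ := (WL X).isPartition.2 (x i, x j)
  have hy := (h 0 i j s hs).1 hx
  have hE : edgeRel X ∈ (WL X).relations :=
    (CoherentConfiguration.coherentClosure_isLeast {edgeRel X}).1 _ rfl
  rw [CoherentConfiguration.mem_relations_iff] at hE
  exact ⟨hE s hs _ hx _ hy, hE s hs _ hy _ hx⟩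

theorem stable_of_mem_class {Ω : Type*} [Finite Ω] {m : ℕ} {C : CoherentConfiguration Ω}
    {Λ : (WLm m C).S} {x y : Fin m → Ω} (hx : x ∈ Λ.1) (hy : y ∈ Λ.1) :
    WeisfeilerLeman.stable m C x y := by
  obtain ⟨Λ, z, rfl⟩ := Λ
  exact (WeisfeilerLeman.stable m C).trans hx ((WeisfeilerLeman.stable m C).symm hy)

theorem MAryAlgIso.adj_iff {m : ℕ} (hm : 2 ≤ m) {Ω Ω' : Type*} [Finite Ω] [Finite Ω']
    {X : SimpleGraph Ω} {X' : SimpleGraph Ω'} (ψ : MAryAlgIso (WLm m (WL X)) (WLm m (WL X')))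
    (hψ : ψ.map2 hm (edgeRel X) = edgeRel X') {x : Fin m → Ω} {x' : Fin m → Ω'}
    (e : ψ.toEquiv ((WLm m (WL X)).cls x) = (WLm m (WL X')).cls x') :
    X.Adj (x ⟨0, by omega⟩) (x ⟨1, by omega⟩) ↔ X'.Adj (x' ⟨0, by omega⟩) (x' ⟨1, by omega⟩) := by
  constructor
  · intro hx
    have : (x' ⟨0, by omega⟩, x' ⟨1, by omega⟩) ∈ edgeRel X' := by
      rw [← hψ]
      refine ⟨(WLm m (WL X)).cls x, ?_, x', (WLm m (WL X')).cls_eq_iff.1 e.symm, rfl⟩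
      rintro _ ⟨y, hy, rfl⟩
      exact (adj_iff_of_stable (stable_of_mem_class ((WLm m (WL X)).mem_cls x) hy) _ _).1 hx
    exact this
  · intro hx'
    have : (x' ⟨0, by omega⟩, x' ⟨1, by omega⟩) ∈ edgeRel X' := hx'
    rw [← hψ] at this
    obtain ⟨Λ, hΛ, y', hy', hyx⟩ := this
    obtain ⟨y, hy⟩ := Setoid.nonempty_of_mem_partition (WLm m (WL X)).isPartition Λ.2
    have hyE : X.Adj (y ⟨0, by omega⟩) (y ⟨1, by omega⟩) := hΛ ⟨y, hy, rfl⟩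
    -- Membership in `map2` only gives a tuple `y'` sharing its first two entries with `x'`,
    -- possibly in another class. Collapsing by `σ` forgets the other entries, so `x ∘ σ` and `y ∘
    -- σ` lie in one class.
    let σ : Fin m → Fin m := fun i => if i = ⟨0, by omega⟩ then ⟨0, by omega⟩ else ⟨1, by omega⟩
    have hσ : y' ∘ σ = x' ∘ σ := by
      rw [Prod.mk.injEq] at hyx
      funext i
      simp only [σ, Function.comp_apply]
      split_ifs
      · exact hyx.1
      · exact hyx.2
    have ey : ψ.toEquiv ((WLm m (WL X)).cls y) = (WLm m (WL X')).cls y' := by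
      rw [(WLm m (WL X)).cls_eq_iff.2 hy, (WLm m (WL X')).cls_eq_iff.2 hy']
    have h₁ := ψ.tupleMatching.comp _ _ ey σ
    have h₂ := ψ.tupleMatching.comp _ _ e σ
    rw [hσ, ← h₂] at h₁
    have h₃ := (WLm m (WL X)).cls_eq_iff.1 (ψ.toEquiv.injective h₁)
    have h₄ := adj_iff_of_stable
      (stable_of_mem_class h₃ ((WLm m (WL X)).mem_cls (x ∘ σ))) ⟨0, by omega⟩ ⟨1, by omega⟩
    simpa [σ] using h₄.1 (by simpa [σ] using hyE)

/-! ### Construction of the two isomorphisms. -/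

open CoherentConfiguration TupleMatching in
theorem theorem3p1 {Ω Ω' : Type*} [Finite Ω] [Finite Ω'] (m : ℕ) (hm : 6 ≤ m)
    (X : SimpleGraph Ω) (X' : SimpleGraph Ω')
    (h : WLEquivalent m (le_trans (by norm_num) hm) X X') :
    ∃ (φ : AlgIso (WL X) (WL X')) (φhat : AlgIso (WL X).twoExtension (WL X').twoExtension),
      φ.map (edgeRel X) = edgeRel X' ∧
      ∀ s ∈ (WL X).relations, ∀ i j : Fin 2,
        cyl s i j ∈ (WL X).twoExtension.relations ∧
        φhat.map (cyl s i j) = cyl (φ.map s) i j := by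
  obtain ⟨ψ, hψ⟩ := h
  -- Padding: every coordinate from `5` on repeats the last entry of the `6`-tuple.
  let τ : Fin m → Fin 6 := fun i => ⟨min i 5, by omega⟩
  have T := ψ.tupleMatching.shorten (Fin.castLE hm) τ (fun i => Fin.ext (by simp [τ]; omega))
  have hE : Matches (fun p => ψ.toEquiv ((WLm m (WL X)).cls (pairTuple p ∘ τ)))
      (fun p => (WLm m (WL X')).cls (pairTuple p ∘ τ)) (edgeRel X) (edgeRel X') :=
    fun p p' e => ψ.adj_iff _ hψ e
  have hmE : edgeRel X ∈ (WL X).relations := (coherentClosure_isLeast {edgeRel X}).1 _ rfl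
  obtain ⟨φ, hφ, hφr⟩ := T.pairMatching.exists_algIso (R := {edgeRel X}) (R' := {edgeRel X'})
    (by rintro u rfl; exact ⟨_, rfl, hE⟩) (by rintro u rfl; exact ⟨_, rfl, hE⟩)
  have hΔ : Matches (fun p => ψ.toEquiv ((WLm m (WL X)).cls (quadTuple p ∘ τ)))
      (fun p => (WLm m (WL X')).cls (quadTuple p ∘ τ))
      {p | p.1 = p.2 ∧ p.1.1 = p.1.2} {p | p.1 = p.2 ∧ p.1.1 = p.1.2} :=
    fun p p' e => and_congr (T.quadMatching.diag p p' e) (T.eq_iff _ _ e 0 1)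
  -- The generators of the two 2-extensions are paired through `φ` itself, which ties `φhat` to `φ`.
  have hT : ∀ s t : (WL X).S, Matches
      (fun p => ψ.toEquiv ((WLm m (WL X)).cls (quadTuple p ∘ τ)))
      (fun p => (WLm m (WL X')).cls (quadTuple p ∘ τ))
      (relTensor s.1 t.1) (relTensor (φ.toEquiv s).1 (φ.toEquiv t).1) :=
    fun s t p p' e => and_congr (hφ s _ _ (T.pair_of_quad_eq e 0 0))
      (hφ t _ _ (T.pair_of_quad_eq e 1 1))
  obtain ⟨φhat, -, hφhat⟩ := T.quadMatching.exists_algIso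
    (R := ((WL X).tensor (WL X)).S ∪ {{p | p.1 = p.2 ∧ p.1.1 = p.1.2}})
    (R' := ((WL X').tensor (WL X')).S ∪ {{p | p.1 = p.2 ∧ p.1.1 = p.1.2}})
    (by
      rintro u (⟨s, hs, t, ht, rfl⟩ | rfl)
      · exact ⟨_, Or.inl ⟨_, (φ.toEquiv ⟨s, hs⟩).2, _, (φ.toEquiv ⟨t, ht⟩).2, rfl⟩,
          hT ⟨s, hs⟩ ⟨t, ht⟩⟩
      · exact ⟨_, Or.inr rfl, hΔ⟩)
    (by
      rintro u (⟨s, hs, t, ht, rfl⟩ | rfl)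
      · refine ⟨_, Or.inl ⟨_, (φ.toEquiv.symm ⟨s, hs⟩).2, _, (φ.toEquiv.symm ⟨t, ht⟩).2, rfl⟩, ?_⟩
        have := hT (φ.toEquiv.symm ⟨s, hs⟩) (φ.toEquiv.symm ⟨t, ht⟩)
        rwa [Equiv.apply_symm_apply, Equiv.apply_symm_apply] at this
      · exact ⟨_, Or.inr rfl, hΔ⟩)
  refine ⟨φ, φhat, T.pairMatching.matches_right_unique (hφr _ hmE) hE, fun s hs i j => ?_⟩
  have hcyl := (WL X).cyl_mem_twoExtension hs i j
  -- Both sides match `cyl s i j`: one as its image under `φhat`, the other because quadruple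
  -- colours determine pair colours.
  exact ⟨hcyl, T.quadMatching.matches_right_unique (hφhat _ hcyl)
    fun p p' e => hφr s hs _ _ (T.pair_of_quad_eq e i j)⟩
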